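/- Let $\mathcal E$ be the ring of germs at the origin of smooth ($C^\infty$) functions of two real variables $(x,\lambda)$. Let $\prec$ be a local order, i.e. a strict total order on the monomials $x^i\lambda^j$ such that $u\prec v$ implies $uw\prec vw$ for all monomials $u,v,w$, and such that $x\prec 1$ and $\lambda\prec 1$. For $f\in\mathcal E$ with Taylor series $\sum a_{ij}x^i\lambda^j$ at the origin, let $\mathrm{Terms}(f)=\{a_{ij}x^i\lambda^j : a_{ij}\ne 0\}$. The germ $f$ is called flat if $\mathrm{Terms}(f)=\emptyset$. The leading term $LT(f)$ is the term of $f$ with the $\prec$-largest monomial, and $LT(f)=0$ if $f$ is flat; the leading coefficient $LC(f)$ is the coefficient of $LT(f)$. Divisibility is in $\mathcal E$. A finite family $g_1,\dots,g_m$ is a standard basis of the ideal $I$ it generates if the ideal $\langle LT(h) : h\in I\rangle$ of $\mathcal E$ equals $\langle LT(g_1),\dots,LT(g_m)\rangle$. Theorem. Let $I=\langle f_1,\dots,f_n\rangle$ be the ideal of $\mathcal E$ generated by germs $f_1,\dots,f_n$. (1) There are $m\le n$ and germs $g_1,\dots,g_m\in\mathcal E$ with $I=\langle g_1,\dots,g_m\rangle$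 such that, for all $i,j$, $LT(g_i)$ divides no $p\in\mathrm{Terms}(g_j)$, except when $i=j$ and $p=LT(g_i)$. (2) If $f_1,\dots,f_n$ is a standard basis of $I$, then there are $m\le n$ and a reduced standard basis $g_1,\dots,g_m$ of $I$, that is, a standard basis of $I$ which satisfies the divisibility condition in (1) and for which $LC(g_i)=1$ for every $g_i$ that is not flat. Moreover, it can be chosen so that no flat $g_j$ lies in the ideal generated by the other $g_i$. -/

import Mathlib

open Filter Topology
open scoped ContDiff

noncomputable section

/-- The ring `𝓔` of smooth real-valued germs at the origin of the `(x, l)`-plane: the germs that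
have a representative which is `C^∞` on a neighbourhood of the origin. (Being `C^∞` at all points
near the origin is required, as `ContDiffAt ℝ ∞ f 0` alone would let the neighbourhood shrink with
the order of differentiation.) -/
def smoothGermRing : Subring (Germ (𝓝 (0 : ℝ × ℝ)) ℝ) where
  carrier := {φ | ∃ f : ℝ × ℝ → ℝ, φ = ↑f ∧ ∀ᶠ p in 𝓝 (0 : ℝ × ℝ), ContDiffAt ℝ ∞ f p}
  mul_mem' := by
    rintro _ _ ⟨f, rfl, hf⟩ ⟨g, rfl, hg⟩
    exact ⟨f * g, rfl, by filter_upwards [hf, hg] with p h1 h2 using h1.mul h2⟩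
  one_mem' := ⟨1, rfl, Eventually.of_forall fun _ => contDiffAt_const⟩
  add_mem' := by
    rintro _ _ ⟨f, rfl, hf⟩ ⟨g, rfl, hg⟩
    exact ⟨f + g, rfl, by filter_upwards [hf, hg] with p h1 h2 using h1.add h2⟩
  zero_mem' := ⟨0, rfl, Eventually.of_forall fun _ => contDiffAt_const⟩
  neg_mem' := by
    rintro _ ⟨f, rfl, hf⟩
    exact ⟨-f, rfl, by filter_upwards [hf] with p h1 using h1.neg⟩

/-- The type of smooth germs `𝓔`, a commutative ring. -/
abbrev SmoothGerm : Type := smoothGermRing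

/-- The partial derivative in the first variable `x`. -/
def partialX (f : ℝ × ℝ → ℝ) : ℝ × ℝ → ℝ := fun p => fderiv ℝ f p (1, 0)

/-- The partial derivative in the second variable `l`. -/
def partialL (f : ℝ × ℝ → ℝ) : ℝ × ℝ → ℝ := fun p => fderiv ℝ f p (0, 1)

theorem partialX_iterate_congr {f g : ℝ × ℝ → ℝ} {a : ℝ × ℝ} (h : f =ᶠ[𝓝 a] g) (n : ℕ) :
    partialX^[n] f =ᶠ[𝓝 a] partialX^[n] g := by
  induction n with
  | zero => exact h
  | succ n ih =>
    rw [Function.iterate_succ_apply', Function.iterate_succ_apply']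
    filter_upwards [ih.fderiv (𝕜 := ℝ)] with p hp
    simp [partialX, hp]

theorem partialL_iterate_congr {f g : ℝ × ℝ → ℝ} {a : ℝ × ℝ} (h : f =ᶠ[𝓝 a] g) (n : ℕ) :
    partialL^[n] f =ᶠ[𝓝 a] partialL^[n] g := by
  induction n with
  | zero => exact h
  | succ n ih =>
    rw [Function.iterate_succ_apply', Function.iterate_succ_apply']
    filter_upwards [ih.fderiv (𝕜 := ℝ)] with p hp
    simp [partialL, hp]

/-- A local order: a strict total order `≺` on the monomials `x^i l^j`, given through their
exponents `(i, j)`, that is compatible with multiplication and satisfies `x ≺ 1` and `l ≺ 1`. -/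
structure LocalOrder where
  /-- `lt α β` means `X^α ≺ X^β`. -/
  lt : ℕ × ℕ → ℕ × ℕ → Prop
  irrefl : ∀ α, ¬ lt α α
  trans : ∀ α β γ, lt α β → lt β γ → lt α γ
  total : ∀ α β, lt α β ∨ α = β ∨ lt β α
  add_right : ∀ α β γ, lt α β → lt (α + γ) (β + γ)
  x_lt_one : lt (1, 0) (0, 0)
  l_lt_one : lt (0, 1) (0, 0)

/-- Multiplying a monomial by a nontrivial one makes it smaller. -/
theorem LocalOrder.lt_of_lt (ord : LocalOrder) {α β : ℕ × ℕ} (h : α < β) : ord.lt β α := by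
  have key : ∀ γ : ℕ × ℕ, γ = 0 ∨ ord.lt γ 0 := by
    have hx : ∀ i : ℕ, (i, 0) = (0 : ℕ × ℕ) ∨ ord.lt (i, 0) 0 := by
      intro i
      induction i with
      | zero => exact Or.inl rfl
      | succ i ih =>
        have h1 := ord.add_right _ _ (i, 0) ord.x_lt_one
        simp only [Prod.mk_add_mk, zero_add, add_zero, add_comm 1 i] at h1
        rcases ih with h0 | h0
        · rw [h0] at h1; exact Or.inr h1
        · exact Or.inr (ord.trans _ _ _ h1 h0)
    rintro ⟨i, j⟩
    induction j with
    | zero => exact hx i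
    | succ j ih =>
      have h1 := ord.add_right _ _ (i, j) ord.l_lt_one
      simp only [Prod.mk_add_mk, zero_add, add_comm 1 j] at h1
      rcases ih with h0 | h0
      · rw [h0] at h1; exact Or.inr h1
      · exact Or.inr (ord.trans _ _ _ h1 h0)
  obtain ⟨γ, rfl⟩ := exists_add_of_le h.le
  rcases key γ with h0 | h0
  · subst h0; simp at h
  · have := ord.add_right _ _ α h0
    rwa [zero_add, add_comm] at this

/-- Every nonempty set of monomials has a maximum with respect to a local order. -/
theorem LocalOrder.exists_max (ord : LocalOrder) {S : Set (ℕ × ℕ)} (hS : S.Nonempty) :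
    ∃ α ∈ S, ∀ β ∈ S, β ≠ α → ord.lt β α := by
  have hwf : WellFounded (fun α β => ord.lt β α) := by
    have : IsStrictOrder (ℕ × ℕ) (fun α β => ord.lt β α) :=
      { irrefl := ord.irrefl
        trans := fun a b c h1 h2 => ord.trans _ _ _ h2 h1 }
    rw [RelEmbedding.wellFounded_iff_isEmpty]
    constructor
    intro u
    obtain ⟨m, n, hmn, hle⟩ := wellQuasiOrdered_le (α := ℕ × ℕ) u
    have h1 : ord.lt (u m) (u n) := u.map_rel_iff.2 hmn
    rcases hle.eq_or_lt with h | h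
    · rw [h] at h1; exact ord.irrefl _ h1
    · exact ord.irrefl _ (ord.trans _ _ _ h1 (ord.lt_of_lt h))
  obtain ⟨α, hα, hmax⟩ := hwf.has_min S hS
  refine ⟨α, hα, fun β hβ hne => ?_⟩
  rcases ord.total β α with h | h | h
  · exact h
  · exact absurd h hne
  · exact absurd h (hmax β hβ)

namespace SmoothGerm

/-- The Taylor coefficient of `x^i l^j` of a smooth germ at the origin, for `α = (i, j)`. -/
def taylorCoeff (φ : SmoothGerm) (α : ℕ × ℕ) : ℝ :=
  Germ.liftOn φ.1 (fun f => partialX^[α.1] (partialL^[α.2] f) 0 / (Nat.factorial α.1 * Nat.factorial α.2))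
    (fun _ _ h => by
      have := (partialX_iterate_congr (partialL_iterate_congr h α.2) α.1).eq_of_nhds
      simp only [this])

/-- The term `c x^i l^j` as a smooth germ, for `α = (i, j)`. -/
def term (c : ℝ) (α : ℕ × ℕ) : SmoothGerm :=
  ⟨↑(fun p : ℝ × ℝ => c * (p.1 ^ α.1 * p.2 ^ α.2)), _, rfl, Eventually.of_forall fun _ =>
    ContDiff.contDiffAt (by fun_prop)⟩

/-- The exponents of the monomials that occur in the Taylor series of `φ`. -/
def support (φ : SmoothGerm) : Set (ℕ × ℕ) := {α | taylorCoeff φ α ≠ 0}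

/-- A germ is flat when its Taylor series at the origin vanishes. -/
def IsFlat (φ : SmoothGerm) : Prop := ∀ α, taylorCoeff φ α = 0

/-- The set of terms that occur in the Taylor series of `φ`. -/
def terms (φ : SmoothGerm) : Set SmoothGerm := {p | ∃ α ∈ support φ, p = term (taylorCoeff φ α) α}

open Classical in
/-- The exponent of the leading monomial of a germ that is not flat (`0` for a flat germ). -/
def leadExp (ord : LocalOrder) (φ : SmoothGerm) : ℕ × ℕ :=
  if h : (support φ).Nonempty then (ord.exists_max h).choose else 0

/-- The leading coefficient of `φ` (which is `0` when `φ` is flat). -/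
def leadCoeff (ord : LocalOrder) (φ : SmoothGerm) : ℝ := taylorCoeff φ (leadExp ord φ)

/-- The leading term of `φ`: its largest term, and `0` when `φ` is flat. -/
def leadTerm (ord : LocalOrder) (φ : SmoothGerm) : SmoothGerm :=
  term (leadCoeff ord φ) (leadExp ord φ)

/-- The leading term ideal of an ideal of `𝓔`. -/
def leadTermIdeal (ord : LocalOrder) (I : Ideal SmoothGerm) : Ideal SmoothGerm :=
  Ideal.span {p | ∃ φ ∈ I, p = leadTerm ord φ}

/-- `g₁, …, gₘ` generate `I`, and their leading terms generate the leading term ideal of `I`. -/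
def IsStandardBasis (ord : LocalOrder) {m : ℕ} (g : Fin m → SmoothGerm)
    (I : Ideal SmoothGerm) : Prop :=
  Ideal.span (Set.range g) = I ∧
    leadTermIdeal ord I = Ideal.span (Set.range fun i => leadTerm ord (g i))

/-- No leading term `LT(gᵢ)` divides a term of some `gⱼ`, apart from `LT(gᵢ)` as a term of `gᵢ`. -/
def LeadTermsDivideNoTerms (ord : LocalOrder) {m : ℕ} (g : Fin m → SmoothGerm) : Prop :=
  ∀ i j, ∀ p ∈ terms (g j), ¬ (i = j ∧ p = leadTerm ord (g i)) → ¬ leadTerm ord (g i) ∣ p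

/-- A reduced standard basis of `I`. The leading coefficient is normalized to `1` for the members
that are not flat; a flat member has no terms and hence no leading coefficient to normalize. -/
def IsReducedStandardBasis (ord : LocalOrder) {m : ℕ} (g : Fin m → SmoothGerm)
    (I : Ideal SmoothGerm) : Prop :=
  IsStandardBasis ord g I ∧ (∀ i, ¬ IsFlat (g i) → leadCoeff ord (g i) = 1) ∧
    LeadTermsDivideNoTerms ord g

end SmoothGerm

end

/-! Leading terms and terms see only Taylor series, and by Borel's theorem (`exists_taylorCoeff_eq`)
every formal series is the Taylor series of a germ. Since Taylor coefficients of products are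
convolutions (`taylorCoeff_mul`), division can be done formally and its quotients lifted to germs
(`exists_division`). The lifted remainder has the prescribed vanishing coefficients; its unknown
flat part does no harm. Formal division itself (`exists_formal_division`) is a recursion from large
monomials to small ones, which is well founded because every nonempty set of monomials has a
maximum.

Generators are then interreduced without changing the ideal or their number. In `exists_antichain`,
a generator whose leading monomial is divisible by another one is replaced by its remainder modulo
the others. This ends because either the set of monomials covered by leading monomials grows, which
Dickson's lemma bounds, or it stays the same and one more generator becomes flat. In
`exists_tail_reduced`, each tail is divided by all nonflat generators, the generator itself
included; its own quotient has zero constant term, so its coefficient in the new combination is a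
unit.

Covered monomials are never lost, so a standard basis stays one. Flat generators have leading term 0
and divide no term, but need not be redundant; a reduced standard basis of least length contains no
redundant flat one. -/

namespace SmoothGerm

/-! ### Derivations on germs and Taylor coefficients of products -/

/-- The germ of a function that is smooth near the origin. -/
noncomputable def ofFun (f : ℝ × ℝ → ℝ) (hf : ∀ᶠ p in 𝓝 (0 : ℝ × ℝ), ContDiffAt ℝ ∞ f p) : SmoothGerm :=
  ⟨↑f, f, rfl, hf⟩

theorem exists_ofFun (φ : SmoothGerm) : ∃ f hf, φ = ofFun f hf := by
  obtain ⟨_, f, rfl, hf⟩ := φ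
  exact ⟨f, hf, rfl⟩

theorem eventually_contDiffAt_fderiv {f : ℝ × ℝ → ℝ}
    (hf : ∀ᶠ p in 𝓝 (0 : ℝ × ℝ), ContDiffAt ℝ ∞ f p) (v : ℝ × ℝ) :
    ∀ᶠ p in 𝓝 (0 : ℝ × ℝ), ContDiffAt ℝ ∞ (fun q => fderiv ℝ f q v) p := by
  filter_upwards [hf] with p hp
  exact (hp.fderiv_right (m := ∞) (by simp)).clm_apply contDiffAt_const

/-- The derivative of a smooth germ in the direction `v`. -/
noncomputable def dirDeriv (v : ℝ × ℝ) : AddMonoid.End SmoothGerm where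
  toFun φ := ⟨Germ.liftOn φ.1 (fun f => Germ.ofFun (l := 𝓝 (0 : ℝ × ℝ)) (fun p => fderiv ℝ f p v))
      (fun f g (h : f =ᶠ[𝓝 0] g) => Germ.coe_eq.2 (by
        filter_upwards [h.fderiv (𝕜 := ℝ)] with p hp
        rw [hp])), by
    obtain ⟨_, f, rfl, hf⟩ := φ
    exact ⟨_, rfl, eventually_contDiffAt_fderiv hf v⟩⟩
  map_zero' := by
    refine Subtype.ext (Germ.coe_eq.2 (Eventually.of_forall fun p => ?_))
    exact (by simp : fderiv ℝ (fun _ : ℝ × ℝ => (0 : ℝ)) p v = 0)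
  map_add' := by
    rintro ⟨_, f, rfl, hf⟩ ⟨_, g, rfl, hg⟩
    refine Subtype.ext (Germ.coe_eq.2 ?_)
    filter_upwards [hf, hg] with p h1 h2
    have := fderiv_add (h1.differentiableAt (by simp)) (h2.differentiableAt (by simp))
    exact congrArg (fun L : ℝ × ℝ →L[ℝ] ℝ => L v) this

theorem dirDeriv_mul (v : ℝ × ℝ) (φ ψ : SmoothGerm) :
    dirDeriv v (φ * ψ) = φ * dirDeriv v ψ + dirDeriv v φ * ψ := by
  obtain ⟨_, f, rfl, hf⟩ := φ
  obtain ⟨_, g, rfl, hg⟩ := ψ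
  refine Subtype.ext (Germ.coe_eq.2 ?_)
  filter_upwards [hf, hg] with p h1 h2
  have := fderiv_mul (h1.differentiableAt (by simp)) (h2.differentiableAt (by simp))
  have h3 := congrArg (fun L : ℝ × ℝ →L[ℝ] ℝ => L v) this
  simp only [add_apply, smul_apply, smul_eq_mul] at h3
  rw [mul_comm (g p)] at h3
  exact h3

theorem addEnd_mul_apply {M : Type*} [AddCommMonoid M] (f g : AddMonoid.End M)
    (a : M) : (f * g) a = f (g a) := rfl

/-- The iterated Leibniz rule for an additive map satisfying the Leibniz rule. -/
theorem pow_leibniz {R : Type*} [CommRing R] (D : AddMonoid.End R)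
    (hD : ∀ a b, D (a * b) = a * D b + D a * b) (n : ℕ) (a b : R) :
    (D ^ n) (a * b) = ∑ p ∈ Finset.HasAntidiagonal.antidiagonal n, n.choose p.1 • ((D ^ p.1) a * (D ^ p.2) b) := by
  induction n with
  | zero => simp
  | succ n ih =>
    rw [Finset.sum_antidiagonal_choose_succ_nsmul (fun i j => (D ^ i) a * (D ^ j) b) n]
    simp only [pow_succ', addEnd_mul_apply, ih, map_sum, map_nsmul, hD, nsmul_add,
      Finset.sum_add_distrib]
    congr 1
    refine Finset.sum_congr rfl fun ⟨i, j⟩ hij => ?_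
    rw [n.choose_symm_of_eq_add (Finset.HasAntidiagonal.mem_antidiagonal.1 hij).symm]

/-- The value of a germ at the origin. -/
noncomputable def valueHom : SmoothGerm →+* ℝ := Germ.valueRingHom.comp smoothGermRing.subtype

theorem valueHom_ofFun (f : ℝ × ℝ → ℝ) (hf) : valueHom (ofFun f hf) = f 0 := rfl

theorem dirDeriv_ofFun (v : ℝ × ℝ) (f : ℝ × ℝ → ℝ) (hf) :
    dirDeriv v (ofFun f hf) = ofFun (fun p => fderiv ℝ f p v) (eventually_contDiffAt_fderiv hf v) :=
  rfl

theorem exists_dirDeriv_pow_ofFun (f : ℝ × ℝ → ℝ) (hf) (i j : ℕ) :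
    ∃ h, (dirDeriv (1, 0) ^ i) ((dirDeriv (0, 1) ^ j) (ofFun f hf)) =
      ofFun (partialX^[i] (partialL^[j] f)) h := by
  induction i with
  | zero =>
    induction j with
    | zero => exact ⟨hf, rfl⟩
    | succ j ih =>
      obtain ⟨h, ih⟩ := ih
      simp only [pow_zero, AddMonoid.End.one_apply, Function.iterate_zero, id_eq] at ih h
      simp only [pow_zero, AddMonoid.End.one_apply, pow_succ', addEnd_mul_apply, ih,
        Function.iterate_succ_apply', Function.iterate_zero, id_eq]
      exact ⟨eventually_contDiffAt_fderiv h _, dirDeriv_ofFun _ _ h⟩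
  | succ i ih =>
    obtain ⟨h, ih⟩ := ih
    simp only [pow_succ' _ i, addEnd_mul_apply, ih, Function.iterate_succ_apply']
    exact ⟨eventually_contDiffAt_fderiv h _, dirDeriv_ofFun _ _ h⟩

theorem taylorCoeff_ofFun (f : ℝ × ℝ → ℝ) (hf) (α : ℕ × ℕ) :
    taylorCoeff (ofFun f hf) α =
      partialX^[α.1] (partialL^[α.2] f) 0 / (Nat.factorial α.1 * Nat.factorial α.2) := rfl

/-- Expressing the coefficient through additive operators on the ring of germs lets additivity and
the Leibniz rule be used without differentiability side conditions. -/
theorem taylorCoeff_eq (φ : SmoothGerm) (α : ℕ × ℕ) : taylorCoeff φ α =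
    valueHom ((dirDeriv (1, 0) ^ α.1) ((dirDeriv (0, 1) ^ α.2) φ)) /
      (Nat.factorial α.1 * Nat.factorial α.2) := by
  obtain ⟨f, hf, rfl⟩ := exists_ofFun φ
  obtain ⟨h, e⟩ := exists_dirDeriv_pow_ofFun f hf α.1 α.2
  rw [e, valueHom_ofFun, taylorCoeff_ofFun]

theorem taylorCoeff_add (φ ψ : SmoothGerm) (α : ℕ × ℕ) :
    taylorCoeff (φ + ψ) α = taylorCoeff φ α + taylorCoeff ψ α := by
  simp only [taylorCoeff_eq, map_add, add_div]

/-- The Taylor coefficient as an additive map. -/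
noncomputable def taylorHom (α : ℕ × ℕ) : SmoothGerm →+ ℝ :=
  AddMonoidHom.mk' (fun φ => taylorCoeff φ α) fun φ ψ => taylorCoeff_add φ ψ α

theorem taylorCoeff_sub (φ ψ : SmoothGerm) (α : ℕ × ℕ) :
    taylorCoeff (φ - ψ) α = taylorCoeff φ α - taylorCoeff ψ α := map_sub (taylorHom α) φ ψ

theorem taylorCoeff_zero (α : ℕ × ℕ) : taylorCoeff 0 α = 0 := map_zero (taylorHom α)

theorem taylorCoeff_sum {ι : Type*} (s : Finset ι) (φ : ι → SmoothGerm) (α : ℕ × ℕ) :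
    taylorCoeff (∑ i ∈ s, φ i) α = ∑ i ∈ s, taylorCoeff (φ i) α := map_sum (taylorHom α) φ s

/-- The pairs of exponents with sum `δ`. -/
def splittings (δ : ℕ × ℕ) : Finset ((ℕ × ℕ) × (ℕ × ℕ)) :=
  (Finset.HasAntidiagonal.antidiagonal δ.1 ×ˢ Finset.HasAntidiagonal.antidiagonal δ.2).map
    (Equiv.prodProdProdComm ℕ ℕ ℕ ℕ).toEmbedding

theorem mem_splittings {δ : ℕ × ℕ} {p : (ℕ × ℕ) × (ℕ × ℕ)} : p ∈ splittings δ ↔ p.1 + p.2 = δ := by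
  obtain ⟨⟨a, b⟩, c, d⟩ := p
  obtain ⟨i, j⟩ := δ
  simp only [splittings, Finset.mem_map_equiv]
  simp [Prod.ext_iff]

/-- The coefficients of the product of two power series. -/
def conv (a b : ℕ × ℕ → ℝ) (δ : ℕ × ℕ) : ℝ := ∑ p ∈ splittings δ, a p.1 * b p.2

/-- The iterated Leibniz rule is applied once in each variable; dividing by the factorials absorbs
the binomial coefficients. -/
theorem taylorCoeff_mul (φ ψ : SmoothGerm) (δ : ℕ × ℕ) :
    taylorCoeff (φ * ψ) δ = conv (taylorCoeff φ) (taylorCoeff ψ) δ := by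
  rw [conv, splittings, Finset.sum_map, Finset.sum_product_right, taylorCoeff_eq,
    pow_leibniz _ (dirDeriv_mul _), map_sum, map_sum, Finset.sum_div]
  refine Finset.sum_congr rfl fun q hq => ?_
  rw [map_nsmul, pow_leibniz _ (dirDeriv_mul _), map_nsmul, map_sum, Finset.smul_sum,
    Finset.sum_div]
  refine Finset.sum_congr rfl fun p hp => ?_
  simp only [Equiv.coe_toEmbedding, Equiv.prodProdProdComm_apply, taylorCoeff_eq, map_mul,
    map_natCast, nsmul_eq_mul]
  rw [Finset.HasAntidiagonal.mem_antidiagonal] at hp hq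
  rw [← hp, ← hq, Nat.cast_add_choose, Nat.cast_add_choose]
  have := Nat.factorial_ne_zero
  field_simp

/-! ### Taylor coefficients of monomials, and units -/

theorem partialX_pow (c : ℝ) (a b : ℕ) : partialX (fun p => c * (p.1 ^ a * p.2 ^ b)) =
    fun p => (c * a) * (p.1 ^ (a - 1) * p.2 ^ b) := by
  funext p
  have h : HasFDerivAt (fun p : ℝ × ℝ => c * (p.1 ^ a * p.2 ^ b)) _ p :=
    ((((hasFDerivAt_fst (𝕜 := ℝ) (p := p)).pow a).mul ((hasFDerivAt_snd (𝕜 := ℝ) (p := p)).pow b))).const_mul c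
  rw [partialX, h.fderiv]
  simp
  ring

theorem partialL_pow (c : ℝ) (a b : ℕ) : partialL (fun p => c * (p.1 ^ a * p.2 ^ b)) =
    fun p => (c * b) * (p.1 ^ a * p.2 ^ (b - 1)) := by
  funext p
  have h : HasFDerivAt (fun p : ℝ × ℝ => c * (p.1 ^ a * p.2 ^ b)) _ p :=
    ((((hasFDerivAt_fst (𝕜 := ℝ) (p := p)).pow a).mul ((hasFDerivAt_snd (𝕜 := ℝ) (p := p)).pow b))).const_mul c
  rw [partialL, h.fderiv]
  simp
  ring

theorem partialX_iterate_pow (c : ℝ) (a b i : ℕ) :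
    partialX^[i] (fun p => c * (p.1 ^ a * p.2 ^ b)) =
      fun p => (c * a.descFactorial i) * (p.1 ^ (a - i) * p.2 ^ b) := by
  induction i with
  | zero => simp
  | succ i ih =>
    rw [Function.iterate_succ_apply', ih, partialX_pow, Nat.descFactorial_succ]
    push_cast
    funext p
    rw [← Nat.sub_sub]
    ring

theorem partialL_iterate_pow (c : ℝ) (a b i : ℕ) :
    partialL^[i] (fun p => c * (p.1 ^ a * p.2 ^ b)) =
      fun p => (c * b.descFactorial i) * (p.1 ^ a * p.2 ^ (b - i)) := by
  induction i with
  | zero => simp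
  | succ i ih =>
    rw [Function.iterate_succ_apply', ih, partialL_pow, Nat.descFactorial_succ]
    push_cast
    funext p
    rw [← Nat.sub_sub]
    ring

theorem descFactorial_mul_zero_pow (a i : ℕ) :
    (a.descFactorial i : ℝ) * 0 ^ (a - i) = if i = a then (i.factorial : ℝ) else 0 := by
  rcases lt_trichotomy i a with h | rfl | h
  · rw [zero_pow (by omega), mul_zero, if_neg h.ne]
  · simp [Nat.descFactorial_self]
  · simp [Nat.descFactorial_of_lt h, h.ne']

theorem partial_pow_zero (c : ℝ) (α β : ℕ × ℕ) :
    partialX^[β.1] (partialL^[β.2] (fun p => c * (p.1 ^ α.1 * p.2 ^ α.2))) 0 =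
      if β = α then c * (β.1.factorial * β.2.factorial) else 0 := by
  rw [partialL_iterate_pow, partialX_iterate_pow]
  simp only [Prod.fst_zero, Prod.snd_zero]
  rw [show ∀ x y z u : ℝ, c * x * y * (z * u) = c * ((y * z) * (x * u)) by intros; ring,
    descFactorial_mul_zero_pow, descFactorial_mul_zero_pow]
  have := Prod.ext_iff (x := β) (y := α)
  split_ifs <;> simp_all

theorem taylorCoeff_term (c : ℝ) (α β : ℕ × ℕ) :
    taylorCoeff (term c α) β = if β = α then c else 0 := by
  have h := partial_pow_zero c α β
  have e : taylorCoeff (term c α) β = partialX^[β.1] (partialL^[β.2]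
    (fun p => c * (p.1 ^ α.1 * p.2 ^ α.2))) 0 / (β.1.factorial * β.2.factorial) := rfl
  rw [e, h]
  have := Nat.factorial_ne_zero
  split_ifs
  · field_simp
  · simp

/-- The constant coefficient is the value at the origin, and the reciprocal of a smooth function is
smooth where the function does not vanish. -/
theorem isUnit_of_taylorCoeff_ne_zero {φ : SmoothGerm} (h : taylorCoeff φ 0 ≠ 0) : IsUnit φ := by
  obtain ⟨f, hf, rfl⟩ := exists_ofFun φ
  have h0 : f 0 ≠ 0 := by simpa [taylorCoeff_ofFun] using h
  have hne : ∀ᶠ p in 𝓝 (0 : ℝ × ℝ), f p ≠ 0 := hf.self_of_nhds.continuousAt.eventually_ne h0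
  refine IsUnit.of_mul_eq_one (ofFun (fun p => (f p)⁻¹) ?_) ?_
  · filter_upwards [hf, hne] with p h1 h2 using h1.inv h2
  · refine Subtype.ext (Germ.coe_eq.2 ?_)
    filter_upwards [hne] with p hp using mul_inv_cancel₀ hp

/-! ### Borel's theorem -/

/-- An iterated partial derivative of a smooth function is a value of the iterated Fréchet
derivative. -/
theorem exists_partial_eq_iteratedFDeriv (i j : ℕ) : ∃ v : Fin (i + j) → ℝ × ℝ,
    ∀ f : ℝ × ℝ → ℝ, ContDiff ℝ ∞ f → ∀ p,
      partialX^[i] (partialL^[j] f) p = iteratedFDeriv ℝ (i + j) f p v := by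
  have key : ∀ (n : ℕ) (v : Fin n → ℝ × ℝ) (w : ℝ × ℝ) (f : ℝ × ℝ → ℝ), ContDiff ℝ ∞ f → ∀ p,
      fderiv ℝ (fun q => iteratedFDeriv ℝ n f q v) p w =
        iteratedFDeriv ℝ (n + 1) f p (Fin.cons w v) := by
    intro n v w f hf p
    rw [iteratedFDeriv_succ_apply_left, fderiv_continuousMultilinear_apply_const_apply]
    · simp
    · exact (hf.differentiable_iteratedFDeriv (by exact_mod_cast ENat.natCast_lt_top n)) p
  have hL : ∀ j : ℕ, ∃ v : Fin j → ℝ × ℝ, ∀ f : ℝ × ℝ → ℝ, ContDiff ℝ ∞ f → ∀ p,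
      partialL^[j] f p = iteratedFDeriv ℝ j f p v := by
    intro j
    induction j with
    | zero => exact ⟨Fin.elim0, fun f _ p => by simp⟩
    | succ j ih =>
      obtain ⟨v, hv⟩ := ih
      refine ⟨Fin.cons (0, 1) v, fun f hf p => ?_⟩
      rw [Function.iterate_succ_apply', funext (hv f hf), partialL, key _ _ _ _ hf]
  induction i with
  | zero =>
    obtain ⟨v, hv⟩ := hL j
    rw [Nat.zero_add]
    exact ⟨v, hv⟩
  | succ i ih =>
    obtain ⟨v, hv⟩ := ih
    rw [Nat.succ_add]
    refine ⟨Fin.cons (1, 0) v, fun f hf p => ?_⟩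
    rw [Function.iterate_succ_apply', funext (hv f hf), partialX, key _ _ _ _ hf]

/-- A fixed bump function around the origin. -/
noncomputable def bump : ContDiffBump (0 : ℝ × ℝ) := ⟨1, 2, one_pos, one_lt_two⟩

/-- The monomial `x^i l^j`, cut off outside a neighbourhood of the origin. -/
noncomputable def cutoffMonomial (α : ℕ × ℕ) (p : ℝ × ℝ) : ℝ := p.1 ^ α.1 * p.2 ^ α.2 * bump p

theorem contDiff_cutoffMonomial (α : ℕ × ℕ) : ContDiff ℝ ∞ (cutoffMonomial α) :=
  (ContDiff.mul (contDiff_fst.pow _) (contDiff_snd.pow _)).mul bump.contDiff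

theorem hasCompactSupport_cutoffMonomial (α : ℕ × ℕ) : HasCompactSupport (cutoffMonomial α) :=
  bump.hasCompactSupport.mul_left

theorem exists_bound_iteratedFDeriv_cutoffMonomial (α : ℕ × ℕ) (k : ℕ) :
    ∃ C : ℝ, ∀ p, ‖iteratedFDeriv ℝ k (cutoffMonomial α) p‖ ≤ C :=
  ((hasCompactSupport_cutoffMonomial α).iteratedFDeriv k).exists_bound_of_continuous
    ((contDiff_cutoffMonomial α).continuous_iteratedFDeriv (by exact_mod_cast le_top))

/-- The monomial `c x^i l^j`, cut off at scale `1 / t`. -/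
noncomputable def scaledMonomial (c t : ℝ) (α : ℕ × ℕ) (p : ℝ × ℝ) : ℝ :=
  (c * (t⁻¹) ^ (α.1 + α.2)) • cutoffMonomial α (t • p)

theorem contDiff_scaledMonomial (c t : ℝ) (α : ℕ × ℕ) : ContDiff ℝ ∞ (scaledMonomial c t α) :=
  ((contDiff_cutoffMonomial α).comp (contDiff_const_smul t)).const_smul _

/-- Each derivative costs one factor `t`, so for `k` below the degree a negative power of `t`
survives and large `t` makes the derivative small. -/
theorem iteratedFDeriv_scaledMonomial (c t : ℝ) (α : ℕ × ℕ) (k : ℕ) (p : ℝ × ℝ) :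
    iteratedFDeriv ℝ k (scaledMonomial c t α) p =
      (c * (t⁻¹) ^ (α.1 + α.2) * t ^ k) • iteratedFDeriv ℝ k (cutoffMonomial α) (t • p) := by
  have h := (contDiff_cutoffMonomial α).of_le (m := (k : ℕ∞ω)) (by exact_mod_cast le_top)
  have h2 : ContDiff ℝ k fun p => cutoffMonomial α (t • p) := h.comp (contDiff_const_smul t)
  unfold scaledMonomial
  rw [iteratedFDeriv_const_smul_apply' h2.contDiffAt, iteratedFDeriv_comp_const_smul _ h, smul_smul]

theorem scaledMonomial_eventuallyEq {t : ℝ} (ht : t ≠ 0) (c : ℝ) (α : ℕ × ℕ) :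
    scaledMonomial c t α =ᶠ[𝓝 0] fun p => c * (p.1 ^ α.1 * p.2 ^ α.2) := by
  have h1 : Tendsto (fun p : ℝ × ℝ => t • p) (𝓝 0) (𝓝 0) := by
    have : Continuous fun p : ℝ × ℝ => t • p := continuous_const_smul t
    simpa using this.tendsto 0
  filter_upwards [h1.eventually bump.eventuallyEq_one] with p hp
  simp only [scaledMonomial, cutoffMonomial, hp, Prod.smul_fst, Prod.smul_snd, smul_eq_mul, mul_pow,
    pow_add, inv_pow, Pi.one_apply]
  field_simp

/-- The scale can be chosen so that all derivatives of low order are small. -/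
theorem exists_scale (c : ℝ) (α : ℕ × ℕ) {ε : ℝ} (hε : 0 < ε) : ∃ t : ℝ, t ≠ 0 ∧
    ∀ k < α.1 + α.2, ∀ p, ‖iteratedFDeriv ℝ k (scaledMonomial c t α) p‖ ≤ ε := by
  choose C hC using exists_bound_iteratedFDeriv_cutoffMonomial α
  have hC0 : ∀ k, 0 ≤ C k := fun k => (norm_nonneg _).trans (hC k 0)
  set B := ∑ k ∈ Finset.range (α.1 + α.2), C k with hB
  have hB0 : 0 ≤ B := Finset.sum_nonneg fun k _ => hC0 k
  have ht : 1 ≤ 1 + |c| * B / ε := le_add_of_nonneg_right (by positivity)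
  -- Any `t ≥ 1` with `|c| * B ≤ ε * t` works: one factor `t⁻¹` absorbs the bound, and the remaining
  -- powers of `t⁻¹` are at most 1.
  refine ⟨1 + |c| * B / ε, by positivity, fun k hk p => ?_⟩
  have hBk : C k ≤ B := Finset.single_le_sum (fun k _ => hC0 k) (Finset.mem_range.2 hk)
  have ht2 : |c| * B ≤ ε * (1 + |c| * B / ε) := by
    rw [mul_add, mul_div_cancel₀ _ hε.ne']; linarith
  generalize 1 + |c| * B / ε = t at *
  have ht0 : 0 < t := one_pos.trans_le ht
  rw [iteratedFDeriv_scaledMonomial, norm_smul, norm_mul, norm_mul, norm_pow, norm_pow,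
    Real.norm_of_nonneg (inv_nonneg.2 ht0.le), Real.norm_of_nonneg ht0.le, Real.norm_eq_abs]
  obtain ⟨d, hd⟩ := Nat.exists_eq_add_of_lt hk
  have e : t⁻¹ ^ (α.1 + α.2) * t ^ k = t⁻¹ ^ d * t⁻¹ := by
    rw [hd, pow_add, pow_add]; simp only [inv_pow, pow_one]; field_simp
  have h3 : t⁻¹ ^ d ≤ 1 := pow_le_one₀ (inv_nonneg.2 ht0.le) (inv_le_one_of_one_le₀ ht)
  calc |c| * t⁻¹ ^ (α.1 + α.2) * t ^ k * ‖iteratedFDeriv ℝ k (cutoffMonomial α) (t • p)‖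
      = |c| * ‖iteratedFDeriv ℝ k (cutoffMonomial α) (t • p)‖ * (t⁻¹ ^ d * t⁻¹) := by
        rw [← e]; ring
    _ ≤ |c| * B * (1 * t⁻¹) := by
        gcongr
        exact (hC k _).trans hBk
    _ ≤ ε := by
        rw [one_mul, ← div_eq_mul_inv, div_le_iff₀ ht0]; exact ht2

theorem contDiff_and_partial_tsum {ι : Type*} {f : ι → ℝ × ℝ → ℝ} (hf : ∀ a, ContDiff ℝ ∞ (f a))
    {v : ℕ → ι → ℝ} (hv : ∀ k, Summable (v k))
    (hvb : ∀ k a p, ‖iteratedFDeriv ℝ k (f a) p‖ ≤ v k a) :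
    ContDiff ℝ ∞ (fun p => ∑' a, f a p) ∧ ∀ (i j : ℕ) (p : ℝ × ℝ),
      partialX^[i] (partialL^[j] (fun p => ∑' a, f a p)) p =
        ∑' a, partialX^[i] (partialL^[j] (f a)) p := by
  have hF : ContDiff ℝ ∞ (fun p => ∑' a, f a p) :=
    contDiff_tsum (N := ⊤) hf (fun k _ => hv k) fun k a p _ => hvb k a p
  refine ⟨hF, fun i j p => ?_⟩
  -- The directions `w` do not depend on the function, so the same evaluation applies to the sum and
  -- to every summand.
  obtain ⟨w, hw⟩ := exists_partial_eq_iteratedFDeriv i j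
  have h1 := iteratedFDeriv_tsum_apply (N := ⊤) hf (fun k _ => hv k)
    (fun k α p _ => hvb k α p) (k := i + j) le_top p
  have h2 : Summable fun a => iteratedFDeriv ℝ (i + j) (f a) p :=
    (hv _).of_norm_bounded fun a => hvb _ a p
  rw [hw _ hF, h1]
  exact (ContinuousMultilinearMap.tsum_eval h2 w).trans (tsum_congr fun a => (hw _ (hf a) p).symm)

/-- Scales for which all derivatives of the scaled monomials have summable bounds. -/
theorem exists_scales (a : ℕ × ℕ → ℝ) : ∃ (t : ℕ × ℕ → ℝ) (v : ℕ → ℕ × ℕ → ℝ), (∀ α, t α ≠ 0) ∧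
    (∀ k, Summable (v k)) ∧
    ∀ k α p, ‖iteratedFDeriv ℝ k (scaledMonomial (a α) (t α) α) p‖ ≤ v k α := by
  obtain ⟨u, hu, hsum⟩ : ∃ u : ℕ × ℕ → ℝ, (∀ α, 0 < u α) ∧ Summable u := by
    refine ⟨fun α => (1 / 2) ^ α.1 * (1 / 2) ^ α.2, fun α => by positivity,
      Summable.mul_of_nonneg summable_geometric_two summable_geometric_two ?_ ?_⟩ <;>
    · intro i
      exact pow_nonneg (by norm_num) i
  choose t ht0 ht using fun α : ℕ × ℕ => exists_scale (a α) α (hu α)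
  have hbound : ∀ (k : ℕ) (α : ℕ × ℕ), ∃ C : ℝ, ∀ p,
      ‖iteratedFDeriv ℝ k (scaledMonomial (a α) (t α) α) p‖ ≤ C := by
    intro k α
    obtain ⟨C, hC⟩ := exists_bound_iteratedFDeriv_cutoffMonomial α k
    refine ⟨‖a α * (t α)⁻¹ ^ (α.1 + α.2) * t α ^ k‖ * C, fun p => ?_⟩
    rw [iteratedFDeriv_scaledMonomial, norm_smul]
    exact mul_le_mul_of_nonneg_left (hC _) (norm_nonneg _)
  choose B hB using hbound
  refine ⟨t, fun k α => if k < α.1 + α.2 then u α else B k α, ht0, fun k => ?_, fun k α p => ?_⟩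
  -- For fixed `k` only the finitely many monomials of degree at most `k` escape the bound `u`.
  · refine hsum.congr_cofinite ?_
    rw [EventuallyEq, eventually_cofinite]
    refine (Set.finite_Iic (k, k)).subset fun α hα => ?_
    have : ¬ k < α.1 + α.2 := fun h => hα (if_pos h).symm
    exact ⟨show α.1 ≤ k by omega, show α.2 ≤ k by omega⟩
  · dsimp only
    split_ifs with h
    · exact ht α k h p
    · exact hB k α p

/-- **Borel's theorem**: every family of real numbers is the family of Taylor coefficients of a
smooth germ. -/
theorem exists_taylorCoeff_eq (a : ℕ × ℕ → ℝ) : ∃ φ : SmoothGerm, taylorCoeff φ = a := by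
  obtain ⟨t, v, ht, hv, hvb⟩ := exists_scales a
  obtain ⟨hF, hp⟩ := contDiff_and_partial_tsum (fun α => contDiff_scaledMonomial (a α) (t α) α) hv hvb
  refine ⟨ofFun _ (Eventually.of_forall fun p => hF.contDiffAt), funext fun β => ?_⟩
  -- Near the origin the cutoff equals 1, so each summand has the derivatives of the pure monomial
  -- there.
  have h1 : ∀ α, partialX^[β.1] (partialL^[β.2] (scaledMonomial (a α) (t α) α)) 0 =
      if β = α then a α * (β.1.factorial * β.2.factorial) else 0 := by
    intro α
    rw [← partial_pow_zero]
    exact (partialX_iterate_congr (partialL_iterate_congr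
      (scaledMonomial_eventuallyEq (ht α) _ _) _) _).eq_of_nhds
  rw [taylorCoeff_ofFun, hp, tsum_congr h1, tsum_eq_single β fun α hα => if_neg hα.symm, if_pos rfl]
  have := Nat.factorial_ne_zero
  field_simp

end SmoothGerm

/-! ### Division of formal power series -/

theorem LocalOrder.wellFounded (ord : LocalOrder) : WellFounded fun α β => ord.lt β α := by
  refine WellFounded.wellFounded_iff_has_min.2 fun S hS => ?_
  obtain ⟨α, hα, h⟩ := ord.exists_max hS
  refine ⟨α, hα, fun β hβ hlt => ?_⟩
  have hne : β ≠ α := fun e => ord.irrefl _ (e ▸ hlt)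
  exact ord.irrefl _ (ord.trans _ _ _ hlt (h β hβ hne))

namespace SmoothGerm

open Classical in
/-- Division with remainder of formal power series with respect to a local order: the remainder
`f - ∑ qᵢ gᵢ` has no exponent above a leading exponent `αᵢ`, and no leading exponent of `qᵢ gᵢ`
exceeds all exponents of `f`. -/
theorem exists_formal_division (ord : LocalOrder) {ι : Type*} [Fintype ι] (P : ι → Prop)
    (g : ι → ℕ × ℕ → ℝ) (α : ι → ℕ × ℕ) (hα : ∀ i, P i → g i (α i) ≠ 0)
    (hmax : ∀ i, P i → ∀ β, g i β ≠ 0 → β ≠ α i → ord.lt β (α i)) (f : ℕ × ℕ → ℝ) :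
    ∃ q : ι → ℕ × ℕ → ℝ, (∀ i, ¬ P i → q i = 0) ∧
      (∀ i, P i → ∀ δ, α i ≤ δ → ∑ i, conv (q i) (g i) δ = f δ) ∧
      ∀ i μ, q i μ ≠ 0 → ∃ γ, f γ ≠ 0 ∧ (μ + α i = γ ∨ ord.lt (μ + α i) γ) := by
  have hs : ∀ δ, ∃ o : Option ι, (∀ i, o = some i → P i ∧ α i ≤ δ) ∧
      ((∃ i, P i ∧ α i ≤ δ) → ∃ i, o = some i) := by
    intro δ
    by_cases h : ∃ i, P i ∧ α i ≤ δ
    · obtain ⟨i, hi⟩ := h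
      exact ⟨some i, fun j hj => Option.some.inj hj ▸ hi, fun _ => ⟨i, rfl⟩⟩
    · exact ⟨none, fun j hj => absurd hj (by simp), fun h' => absurd h' h⟩
  choose s hs1 hs2 using hs
  -- At a covered `δ` the recursion computes the coefficient still to be cancelled once all larger
  -- monomials are treated. The single divisor `s δ` cancels it, which fixes one coefficient of its
  -- quotient. The sums stay finite because `δ` has finitely many splittings, even if infinitely
  -- many monomials exceed it.
  let F : ∀ δ, (∀ γ, ord.lt δ γ → ℝ) → ℝ := fun δ rec =>
    if ∃ i, s δ = some i then f δ - ∑ i, ∑ p ∈ splittings δ,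
      (if h : s (p.1 + α i) = some i ∧ ord.lt δ (p.1 + α i)
        then rec (p.1 + α i) h.2 / g i (α i) * g i p.2 else 0) else 0
  let h : ℕ × ℕ → ℝ := ord.wellFounded.fix F
  have hh : ∀ δ, h δ = F δ fun γ _ => h γ := fun δ => ord.wellFounded.fix_eq F δ
  let q : ι → ℕ × ℕ → ℝ := fun i μ => if s (μ + α i) = some i then h (μ + α i) / g i (α i) else 0
  have hq : ∀ δ, h δ = if ∃ i, s δ = some i then f δ - ∑ i, ∑ p ∈ splittings δ,
      (if ord.lt δ (p.1 + α i) then q i p.1 * g i p.2 else 0) else 0 := by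
    intro δ
    rw [hh]
    simp only [F, q]
    congr 2
    refine Finset.sum_congr rfl fun i _ => Finset.sum_congr rfl fun p _ => ?_
    by_cases h1 : s (p.1 + α i) = some i <;> by_cases h2 : ord.lt δ (p.1 + α i) <;> simp [h1, h2]
  refine ⟨q, fun i hi => ?_, fun i hi δ hδ => ?_, fun i μ hμ => ?_⟩
  · funext μ
    exact if_neg fun h1 => hi (hs1 _ i h1).1
  · obtain ⟨k, hk⟩ := hs2 δ ⟨i, hi, hδ⟩
    -- A nonzero product at `δ` either comes from a larger `p.1 + α i`, already subtracted in the
    -- recursion, or uses the leading coefficient of the chosen divisor `k` and contributes exactly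
    -- `h δ`.
    have hsplit : ∀ i, ∀ p ∈ splittings δ, q i p.1 * g i p.2 =
        (if ord.lt δ (p.1 + α i) then q i p.1 * g i p.2 else 0) +
          if k = i ∧ p.2 = α i then h δ else 0 := by
      intro i p hp
      rw [mem_splittings] at hp
      by_cases h2 : p.2 = α i
      · have h3 : p.1 + α i = δ := by rw [← h2, hp]
        rw [h3, if_neg (ord.irrefl δ), zero_add]
        simp only [q, h3, hk, Option.some.injEq, h2, and_true]
        split_ifs with h4
        · rw [div_mul_cancel₀]
          exact hα i (hs1 δ i (h4 ▸ hk)).1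
        · rw [zero_mul]
      · rw [if_neg (c := k = i ∧ p.2 = α i) fun hc => h2 hc.2, add_zero]
        split_ifs with h4
        · rfl
        · by_contra h5
          have h6 := mul_ne_zero_iff.1 h5
          have h7 : s (p.1 + α i) = some i := by
            by_contra h7
            exact h6.1 (if_neg h7)
          apply h4
          have := ord.add_right _ _ p.1 (hmax i (hs1 _ i h7).1 _ h6.2 h2)
          rwa [add_comm, hp, add_comm] at this
    have hαk := (hs1 δ k hk).2
    have e : ∑ i, ∑ p ∈ splittings δ, (if k = i ∧ p.2 = α i then h δ else 0) = h δ := by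
      rw [Finset.sum_eq_single k, Finset.sum_eq_single (δ - α k, α k)]
      · simp
      · rintro ⟨a, b⟩ hp hne
        rw [mem_splittings] at hp
        refine if_neg fun hc => hne ?_
        obtain ⟨-, rfl⟩ := hc
        simp only at hp
        rw [← hp, add_tsub_cancel_right]
      · intro hp
        exact absurd (mem_splittings.2 (tsub_add_cancel_of_le hαk)) hp
      · intro i _ hi
        exact Finset.sum_eq_zero fun p _ => if_neg fun hc => hi hc.1.symm
      · intro hc
        exact absurd (Finset.mem_univ _) hc
    simp only [conv]
    rw [Finset.sum_congr rfl fun i _ => Finset.sum_congr rfl (hsplit i)]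
    simp only [Finset.sum_add_distrib]
    rw [e, hq δ, if_pos ⟨k, hk⟩]
    ring
  -- A nonzero `h δ` stems from `f δ` or from a nonzero `h` at a larger monomial, so induction leads
  -- back to an exponent of `f`.
  · have key : ∀ δ, h δ ≠ 0 → ∃ γ, f γ ≠ 0 ∧ (δ = γ ∨ ord.lt δ γ) := by
      intro δ
      induction δ using ord.wellFounded.induction with
      | _ δ ih =>
      intro hδ
      by_contra! hc
      apply hδ
      rw [hq]
      split_ifs with hsδ
      · have hf : f δ = 0 := by
          by_contra hf
          exact (hc δ hf).1 rfl
        rw [hf, zero_sub, neg_eq_zero]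
        refine Finset.sum_eq_zero fun i _ => Finset.sum_eq_zero fun p _ => ?_
        split_ifs with hlt
        · by_contra h5
          have h6 : h (p.1 + α i) ≠ 0 := by
            intro h6
            apply h5
            simp [q, h6]
          obtain ⟨γ, hγ, h7⟩ := ih _ hlt h6
          apply (hc γ hγ).2
          rcases h7 with h7 | h7
          · exact h7 ▸ hlt
          · exact ord.trans _ _ _ hlt h7
        · rfl
      · rfl
    apply key
    intro h0
    apply hμ
    simp [q, h0]

/-! ### Divisibility of terms and leading exponents -/

theorem conv_ne_zero {a b : ℕ × ℕ → ℝ} {δ : ℕ × ℕ} (h : conv a b δ ≠ 0) :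
    ∃ μ ν, μ + ν = δ ∧ a μ ≠ 0 ∧ b ν ≠ 0 := by
  obtain ⟨p, hp, hne⟩ := Finset.exists_ne_zero_of_sum_ne_zero h
  exact ⟨p.1, p.2, mem_splittings.1 hp, mul_ne_zero_iff.1 hne⟩

theorem taylorCoeff_term_zero_mul (c : ℝ) (φ : SmoothGerm) (δ : ℕ × ℕ) :
    taylorCoeff (term c 0 * φ) δ = c * taylorCoeff φ δ := by
  rw [taylorCoeff_mul, conv, Finset.sum_eq_single (0, δ)]
  · rw [taylorCoeff_term, if_pos rfl]
  · rintro ⟨a, b⟩ hp hne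
    rw [taylorCoeff_term, if_neg, zero_mul]
    rintro (rfl : a = 0)
    exact hne (by rw [← mem_splittings.1 hp, zero_add])
  · exact fun h => absurd (mem_splittings.2 (zero_add δ)) h

theorem term_mul_term (c d : ℝ) (α β : ℕ × ℕ) : term c α * term d β = term (c * d) (α + β) := by
  refine Subtype.ext (Germ.coe_eq.2 (Eventually.of_forall fun p => ?_))
  simp only [Prod.fst_add, Prod.snd_add, pow_add]
  ring

theorem term_zero_left (α : ℕ × ℕ) : term 0 α = 0 := by
  refine Subtype.ext (Germ.coe_eq.2 (Eventually.of_forall fun p => ?_))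
  exact zero_mul _

theorem term_one_zero : term 1 0 = 1 := by
  refine Subtype.ext (Germ.coe_eq.2 (Eventually.of_forall fun p => ?_))
  simp

/-- Although the cofactor is an arbitrary germ, comparing Taylor coefficients at `β` forces `α ≤ β`.
-/
theorem term_dvd_term_iff {c d : ℝ} (hc : c ≠ 0) (hd : d ≠ 0) {α β : ℕ × ℕ} :
    term c α ∣ term d β ↔ α ≤ β := by
  constructor
  · rintro ⟨φ, h⟩
    have h1 : conv (taylorCoeff (term c α)) (taylorCoeff φ) β ≠ 0 := by
      rw [← taylorCoeff_mul, ← h, taylorCoeff_term, if_pos rfl]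
      exact hd
    obtain ⟨μ, ν, rfl, h2, -⟩ := conv_ne_zero h1
    rw [taylorCoeff_term] at h2
    rw [← (ite_ne_right_iff.1 h2).1]
    exact le_self_add
  · intro h
    refine ⟨term (d / c) (β - α), ?_⟩
    rw [term_mul_term, mul_div_cancel₀ _ hc, add_tsub_cancel_of_le h]

theorem leadExp_spec (ord : LocalOrder) {φ : SmoothGerm} (h : ¬ IsFlat φ) :
    taylorCoeff φ (leadExp ord φ) ≠ 0 ∧
      ∀ β, taylorCoeff φ β ≠ 0 → β ≠ leadExp ord φ → ord.lt β (leadExp ord φ) := by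
  have hne : (support φ).Nonempty := not_forall.1 h
  have := (ord.exists_max hne).choose_spec
  rw [leadExp, dif_pos hne]
  exact this

theorem leadCoeff_ne_zero (ord : LocalOrder) {φ : SmoothGerm} (h : ¬ IsFlat φ) :
    leadCoeff ord φ ≠ 0 := (leadExp_spec ord h).1

theorem not_isFlat {φ : SmoothGerm} {α : ℕ × ℕ} (h : taylorCoeff φ α ≠ 0) : ¬ IsFlat φ :=
  fun hf => h (hf α)

theorem leadExp_eq (ord : LocalOrder) {φ : SmoothGerm} {α : ℕ × ℕ} (h : taylorCoeff φ α ≠ 0)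
    (hmax : ∀ β, taylorCoeff φ β ≠ 0 → β ≠ α → ord.lt β α) : leadExp ord φ = α := by
  obtain ⟨h1, h2⟩ := leadExp_spec ord (not_isFlat h)
  by_contra hne
  exact ord.irrefl _ (ord.trans _ _ _ (hmax _ h1 hne) (h2 _ h (Ne.symm hne)))

theorem leadTerm_of_isFlat (ord : LocalOrder) {φ : SmoothGerm} (h : IsFlat φ) :
    leadTerm ord φ = 0 := by
  rw [leadTerm, leadCoeff, h, term_zero_left]

theorem leadTerm_dvd_term_iff (ord : LocalOrder) {φ : SmoothGerm} (h : ¬ IsFlat φ) {c : ℝ}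
    (hc : c ≠ 0) {β : ℕ × ℕ} : leadTerm ord φ ∣ term c β ↔ leadExp ord φ ≤ β :=
  term_dvd_term_iff (leadCoeff_ne_zero ord h) hc

/-! ### Division of smooth germs -/

open Classical in
/-- Division of a smooth germ by some members of a finite family. -/
theorem exists_division (ord : LocalOrder) {ι : Type*} [Fintype ι] (P : ι → Prop)
    (g : ι → SmoothGerm) (hP : ∀ i, P i → ¬ IsFlat (g i)) (φ : SmoothGerm) :
    ∃ q : ι → SmoothGerm, (∀ i, ¬ P i → q i = 0) ∧
      (∀ i, P i → ∀ δ, leadExp ord (g i) ≤ δ → taylorCoeff (φ - ∑ i, q i * g i) δ = 0) ∧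
      ∀ i μ, taylorCoeff (q i) μ ≠ 0 → ∃ γ, taylorCoeff φ γ ≠ 0 ∧
        (μ + leadExp ord (g i) = γ ∨ ord.lt (μ + leadExp ord (g i)) γ) := by
  obtain ⟨a, ha1, ha2, ha3⟩ := exists_formal_division ord P (fun i => taylorCoeff (g i))
    (fun i => leadExp ord (g i)) (fun i hi => (leadExp_spec ord (hP i hi)).1)
    (fun i hi => (leadExp_spec ord (hP i hi)).2) (taylorCoeff φ)
  have hq : ∀ i, ∃ q : SmoothGerm, taylorCoeff q = a i ∧ (¬ P i → q = 0) := by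
    intro i
    by_cases hi : P i
    · obtain ⟨q, hq⟩ := exists_taylorCoeff_eq (a i)
      exact ⟨q, hq, fun h => absurd hi h⟩
    · exact ⟨0, by rw [ha1 i hi]; exact funext taylorCoeff_zero, fun _ => rfl⟩
  choose q hq1 hq2 using hq
  refine ⟨q, hq2, fun i hi δ hδ => ?_, fun i μ hμ => ha3 i μ (hq1 i ▸ hμ)⟩
  rw [taylorCoeff_sub, taylorCoeff_sum, sub_eq_zero, ← ha2 i hi δ hδ]
  exact Finset.sum_congr rfl fun i _ => by rw [taylorCoeff_mul, hq1]

/-- If all exponents of the dividend are smaller than `α`, so are those of the remainder. -/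
theorem lt_of_taylorCoeff_remainder_ne_zero (ord : LocalOrder) {ι : Type*} [Fintype ι]
    {P : ι → Prop} {g q : ι → SmoothGerm} {φ : SmoothGerm} (hP : ∀ i, P i → ¬ IsFlat (g i))
    (hq0 : ∀ i, ¬ P i → q i = 0)
    (hq : ∀ i μ, taylorCoeff (q i) μ ≠ 0 → ∃ γ, taylorCoeff φ γ ≠ 0 ∧
        (μ + leadExp ord (g i) = γ ∨ ord.lt (μ + leadExp ord (g i)) γ))
    {α : ℕ × ℕ} (hφ : ∀ γ, taylorCoeff φ γ ≠ 0 → ord.lt γ α) {δ : ℕ × ℕ}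
    (hδ : taylorCoeff (φ - ∑ i, q i * g i) δ ≠ 0) : ord.lt δ α := by
  by_cases h : taylorCoeff φ δ = 0
  · rw [taylorCoeff_sub, h, zero_sub, neg_ne_zero, taylorCoeff_sum] at hδ
    obtain ⟨i, -, hi⟩ := Finset.exists_ne_zero_of_sum_ne_zero hδ
    rw [taylorCoeff_mul] at hi
    obtain ⟨μ, ν, rfl, hμ, hν⟩ := conv_ne_zero hi
    have hPi : P i := by
      by_contra hn
      rw [hq0 i hn, taylorCoeff_zero] at hμ
      exact hμ rfl
    obtain ⟨γ, hγ, h1⟩ := hq i μ hμ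
    -- Every exponent of `q i * g i` is at most `μ + leadExp ord (g i)` for some exponent `μ` of `q
    -- i`, hence at most some exponent of `φ`.
    have h2 : ord.lt (μ + leadExp ord (g i)) α := by
      rcases h1 with h1 | h1
      · exact h1 ▸ hφ γ hγ
      · exact ord.trans _ _ _ h1 (hφ γ hγ)
    by_cases h3 : ν = leadExp ord (g i)
    · exact h3 ▸ h2
    · have h4 := ord.add_right _ _ μ ((leadExp_spec ord (hP i hPi)).2 ν hν h3)
      rw [add_comm, add_comm _ μ] at h4
      exact ord.trans _ _ _ h4 h2
  · exact hφ δ h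

/-! ### Interreduction of generators -/

/-- Replacing a generator by a linear combination in which its coefficient is a unit does not change
the ideal. -/
theorem span_range_update {R ι : Type*} [CommRing R] [Fintype ι] [DecidableEq ι] (g c : ι → R)
    (j : ι) (hc : IsUnit (c j)) :
    Ideal.span (Set.range (Function.update g j (∑ i, c i * g i))) = Ideal.span (Set.range g) := by
  apply le_antisymm <;> rw [Ideal.span_le] <;> rintro _ ⟨k, rfl⟩
  · by_cases hk : k = j
    · subst hk
      rw [Function.update_self]
      exact Ideal.sum_mem _ fun i _ => Ideal.mul_mem_left _ _ (Ideal.subset_span ⟨i, rfl⟩)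
    · rw [Function.update_of_ne hk]
      exact Ideal.subset_span ⟨k, rfl⟩
  · set J := Ideal.span (Set.range (Function.update g j (∑ i, c i * g i)))
    have h1 : ∀ i, i ≠ j → g i ∈ J := fun i hi =>
      Ideal.subset_span ⟨i, Function.update_of_ne hi _ _⟩
    by_cases hk : k = j
    · subst hk
      have h2 : ∑ i, c i * g i ∈ J := Ideal.subset_span ⟨k, Function.update_self _ _ _⟩
      rw [← Finset.add_sum_erase _ _ (Finset.mem_univ k)] at h2
      have h3 := (J.add_mem_iff_left (J.sum_mem fun i hi =>
        J.mul_mem_left (c i) (h1 i (Finset.ne_of_mem_erase hi)))).1 h2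
      exact (Ideal.unit_mul_mem_iff_mem J hc).1 h3
    · exact h1 k hk

/-- The exponents of the monomials divisible by a leading monomial of the family. -/
def leadSet (ord : LocalOrder) {ι : Type*} (g : ι → SmoothGerm) : Set (ℕ × ℕ) :=
  {δ | ∃ i, ¬ IsFlat (g i) ∧ leadExp ord (g i) ≤ δ}

theorem isUpperSet_leadSet (ord : LocalOrder) {ι : Type*} (g : ι → SmoothGerm) :
    IsUpperSet (leadSet ord g) := fun _ _ h ⟨i, hi, hle⟩ => ⟨i, hi, hle.trans h⟩

/-- In a strictly ascending chain, pick a new element at each stage. Two of them satisfy `x m ≤ x n`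
with `m < n`, so `x n` already belongs to the `n`-th set, a contradiction. -/
theorem wellFounded_ssuperset_isUpperSet {A : Type*} [Preorder A] [WellQuasiOrderedLE A] :
    WellFounded fun S T : {S : Set A // IsUpperSet S} => T.1 ⊂ S.1 := by
  have : IsStrictOrder {S : Set A // IsUpperSet S} fun S T => T.1 ⊂ S.1 :=
    { irrefl := fun S => ssubset_irrefl S.1
      trans := fun _ _ _ h1 h2 => h2.trans h1 }
  rw [RelEmbedding.wellFounded_iff_isEmpty]
  constructor
  intro u
  have hu : ∀ m n, m < n → (u m).1 ⊂ (u n).1 := fun m n h => u.map_rel_iff.2 h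
  choose x hx1 hx2 using fun n => Set.exists_of_ssubset (hu n (n + 1) n.lt_succ_self)
  obtain ⟨m, n, hmn, hle⟩ := wellQuasiOrdered_le x
  apply hx2 n
  refine (u n).2 hle ?_
  rcases (Nat.succ_le_of_lt hmn).eq_or_lt with h | h
  · exact h ▸ hx1 m
  · exact (hu _ _ h).subset (hx1 m)

open Classical in
/-- A finite family can be replaced by one of the same size that generates the same ideal, and in
which no leading monomial divides another one. -/
theorem exists_antichain (ord : LocalOrder) {ι : Type*} [Fintype ι] (f : ι → SmoothGerm) :
    ∃ g : ι → SmoothGerm, Ideal.span (Set.range g) = Ideal.span (Set.range f) ∧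
      leadSet ord f ⊆ leadSet ord g ∧ ∀ i j, i ≠ j → ¬ IsFlat (g i) → ¬ IsFlat (g j) →
        ¬ leadExp ord (g i) ≤ leadExp ord (g j) := by
  -- The lexicographic measure: first the covered set, which decreases in this order by growing,
  -- then the number of nonflat members.
  let M : (ι → SmoothGerm) → {S : Set (ℕ × ℕ) // IsUpperSet S} × ℕ := fun g =>
    (⟨leadSet ord g, isUpperSet_leadSet ord g⟩, (Finset.univ.filter fun i => ¬ IsFlat (g i)).card)
  have hwf := InvImage.wf M
    ((wellFounded_ssuperset_isUpperSet (A := ℕ × ℕ)).prod_lex (Nat.lt_wfRel.wf))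
  obtain ⟨g, ⟨hg1, hg2⟩, hmin⟩ := hwf.has_min
    {g | Ideal.span (Set.range g) = Ideal.span (Set.range f) ∧ leadSet ord f ⊆ leadSet ord g}
    ⟨f, rfl, subset_rfl⟩
  refine ⟨g, hg1, hg2, fun i j hij hi hj hle => ?_⟩
  -- Dividing only by the other members gives `q j = 0`, so `g j` keeps coefficient 1 in the
  -- remainder and the ideal is preserved.
  have hP : ∀ k, (¬ IsFlat (g k) ∧ k ≠ j) → ¬ IsFlat (g k) := fun k hk => hk.1
  obtain ⟨q, hq1, hq2, -⟩ := exists_division ord (fun k => ¬ IsFlat (g k) ∧ k ≠ j) g hP (g j)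
  set r := g j - ∑ k, q k * g k with hr
  have hr' : r = ∑ k, ((if k = j then 1 else 0) - q k) * g k := by
    simp [hr, sub_mul, Finset.sum_sub_distrib]
  set g' := Function.update g j r with hg'
  have hj' : g' j = r := Function.update_self _ _ _
  have hk' : ∀ k, k ≠ j → g' k = g k := fun k hk => Function.update_of_ne hk _ _
  have hspan : Ideal.span (Set.range g') = Ideal.span (Set.range g) := by
    rw [hg', hr']
    refine span_range_update g _ j ?_
    simp [hq1 j]
  have hsub : leadSet ord g ⊆ leadSet ord g' := by
    rintro δ ⟨k, hk, hkδ⟩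
    by_cases hkj : k = j
    · subst hkj
      exact ⟨i, by rwa [hk' i hij], by rw [hk' i hij]; exact hle.trans hkδ⟩
    · exact ⟨k, by rwa [hk' k hkj], by rwa [hk' k hkj]⟩
  refine hmin g' ⟨hspan.trans hg1, hg2.trans hsub⟩ ?_
  by_cases hflat : IsFlat r
  · have heq : leadSet ord g' = leadSet ord g := by
      refine subset_antisymm ?_ hsub
      rintro δ ⟨k, hk, hkδ⟩
      by_cases hkj : k = j
      · subst hkj
        exact absurd (hj' ▸ hflat) hk
      · rw [hk' k hkj] at hk hkδ
        exact ⟨k, hk, hkδ⟩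
    refine Prod.lex_def.2 (Or.inr ⟨Subtype.ext heq, Finset.card_lt_card ?_⟩)
    rw [Finset.ssubset_iff_of_subset]
    · exact ⟨j, by simpa using hj, by simpa [hj'] using hflat⟩
    · intro k hk
      simp only [Finset.mem_filter, Finset.mem_univ, true_and] at hk ⊢
      by_cases hkj : k = j
      · subst hkj
        exact absurd (hj' ▸ hflat) hk
      · rwa [hk' k hkj] at hk
  -- The new leading exponent lies above none of the other leading exponents. It is not above that
  -- of `g j` either, since that one lies above that of `g i`; so it was not covered before.
  · refine Prod.lex_def.2 (Or.inl ⟨hsub, fun hsup => ?_⟩)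
    have hne : ∀ k, ¬ IsFlat (g k) → k ≠ j → ¬ leadExp ord (g k) ≤ leadExp ord r :=
      fun k h1 h2 h3 => (leadExp_spec ord hflat).1 (hq2 k ⟨h1, h2⟩ _ h3)
    obtain ⟨k, hk, hkle⟩ := hsup ⟨j, by rwa [hj'], by rw [hj']⟩
    by_cases hkj : k = j
    · subst hkj
      exact hne i hi hij (hle.trans hkle)
    · exact hne k hk hkj hkle

open Classical in
-- Flatness and leading exponents stay fixed, and the reducedness of one member depends on the
-- others only through these. Members can therefore be treated one at a time.
theorem exists_tail_reduced (ord : LocalOrder) {ι : Type*} [Fintype ι] (g : ι → SmoothGerm)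
    (s : Finset ι) :
    ∃ g' : ι → SmoothGerm, Ideal.span (Set.range g') = Ideal.span (Set.range g) ∧
      (∀ i, IsFlat (g' i) ↔ IsFlat (g i)) ∧
      (∀ i, ¬ IsFlat (g i) → leadExp ord (g' i) = leadExp ord (g i)) ∧
      ∀ j ∈ s, ¬ IsFlat (g j) → leadCoeff ord (g' j) = 1 ∧ ∀ i, ¬ IsFlat (g i) → ∀ δ,
        taylorCoeff (g' j) δ ≠ 0 → δ ≠ leadExp ord (g j) → ¬ leadExp ord (g i) ≤ δ := by
  induction s using Finset.induction_on with
  | empty => exact ⟨g, rfl, fun _ => Iff.rfl, fun _ _ => rfl, fun _ h => absurd h (by simp)⟩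
  | insert j s hjs ih =>
    obtain ⟨h, hspan, hfl, hle, hred⟩ := ih
    by_cases hj : IsFlat (g j)
    · refine ⟨h, hspan, hfl, hle, fun k hk hkf => ?_⟩
      rcases Finset.mem_insert.1 hk with rfl | hk
      · exact absurd hj hkf
      · exact hred k hk hkf
    have hj0 : ¬ IsFlat (h j) := by rwa [hfl]
    set α := leadExp ord (h j) with hα
    set c := leadCoeff ord (h j) with hc
    have hc0 : c ≠ 0 := leadCoeff_ne_zero ord hj0
    have hcα : taylorCoeff (h j) α = c := rfl
    set φ := h j - term c α with hφ
    have hφlt : ∀ γ, taylorCoeff φ γ ≠ 0 → ord.lt γ α := by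
      intro γ hγ
      rw [hφ, taylorCoeff_sub, taylorCoeff_term] at hγ
      by_cases e : γ = α
      · rw [if_pos e, e, hcα, sub_self] at hγ
        exact absurd rfl hγ
      · rw [if_neg e, sub_zero] at hγ
        exact (leadExp_spec ord hj0).2 γ hγ e
    obtain ⟨q, hq1, hq2, hq3⟩ :=
      exists_division ord (fun k => ¬ IsFlat (h k)) h (fun _ hk => hk) φ
    set r := φ - ∑ i, q i * h i with hr
    have hrlt : ∀ δ, taylorCoeff r δ ≠ 0 → ord.lt δ α := fun δ hδ =>
      lt_of_taylorCoeff_remainder_ne_zero ord (fun _ hk => hk) hq1 hq3 hφlt hδ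
    set ψ := term c⁻¹ 0 * (term c α + r) with hψ
    have hψδ : ∀ δ, taylorCoeff ψ δ = c⁻¹ * ((if δ = α then c else 0) + taylorCoeff r δ) := by
      intro δ
      rw [hψ, taylorCoeff_term_zero_mul, taylorCoeff_add, taylorCoeff_term]
    have hrα : taylorCoeff r α = 0 := hq2 j hj0 α le_rfl
    have hψα : taylorCoeff ψ α = 1 := by
      rw [hψδ, if_pos rfl, hrα, add_zero, inv_mul_cancel₀ hc0]
    have hψr : ∀ δ, taylorCoeff ψ δ ≠ 0 → δ ≠ α → taylorCoeff r δ ≠ 0 := by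
      intro δ h1 h2 h3
      rw [hψδ, if_neg h2, h3] at h1
      simp at h1
    have hψlead : leadExp ord ψ = α :=
      leadExp_eq ord (by rw [hψα]; exact one_ne_zero) fun β h1 h2 => hrlt β (hψr β h1 h2)
    have hψflat : ¬ IsFlat ψ := not_isFlat (α := α) (by rw [hψα]; exact one_ne_zero)
    have hψsum : ψ = ∑ i, (term c⁻¹ 0 * ((if i = j then 1 else 0) - q i)) * h i := by
      simp [hψ, hr, hφ, mul_assoc, ← Finset.mul_sum, sub_mul, Finset.sum_sub_distrib]
      congr 1
      abel
    -- A constant term in `q j` would put an exponent of `φ` at or above `α`, but `φ` is `h j`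
    -- without its leading term.
    have hunit : IsUnit (term c⁻¹ 0 * ((if j = j then 1 else 0) - q j)) := by
      apply isUnit_of_taylorCoeff_ne_zero
      rw [taylorCoeff_term_zero_mul, if_pos rfl, taylorCoeff_sub, ← term_one_zero,
        taylorCoeff_term, if_pos rfl]
      have : taylorCoeff (q j) 0 = 0 := by
        by_contra hne
        obtain ⟨γ, hγ, h1⟩ := hq3 j 0 hne
        rw [zero_add] at h1
        have h2 := hφlt γ hγ
        rcases h1 with h1 | h1
        · exact ord.irrefl _ (h1 ▸ h2)
        · exact ord.irrefl _ (ord.trans _ _ _ h1 h2)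
      rw [this, sub_zero, mul_one]
      exact inv_ne_zero hc0
    have hself : Function.update h j ψ j = ψ := Function.update_self _ _ _
    have hother : ∀ k, k ≠ j → Function.update h j ψ k = h k := fun k hk =>
      Function.update_of_ne hk _ _
    refine ⟨Function.update h j ψ, ?_, fun k => ?_, fun k hk => ?_, fun k hk hkf => ?_⟩
    · rw [← hspan, hψsum]
      exact span_range_update h _ j hunit
    · by_cases hkj : k = j
      · subst hkj
        rw [hself]
        exact iff_of_false hψflat hj
      · rw [hother k hkj, hfl]
    · by_cases hkj : k = j
      · subst hkj
        rw [hself, hψlead, hα, hle k hk]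
      · rw [hother k hkj, hle k hk]
    · by_cases hkj : k = j
      · subst hkj
        rw [hself]
        refine ⟨by rw [leadCoeff, hψlead, hψα], fun i hi δ hδ hne hile => ?_⟩
        rw [← hle k hkf] at hne
        rw [← hle i hi] at hile
        exact hψr δ hδ hne (hq2 i (by rwa [hfl]) δ hile)
      · rw [hother k hkj]
        exact hred k ((Finset.mem_insert.1 hk).resolve_left hkj) hkf

theorem exists_reduced (ord : LocalOrder) {n : ℕ} (f : Fin n → SmoothGerm) :
    ∃ g : Fin n → SmoothGerm, Ideal.span (Set.range g) = Ideal.span (Set.range f) ∧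
      leadSet ord f ⊆ leadSet ord g ∧ (∀ i, ¬ IsFlat (g i) → leadCoeff ord (g i) = 1) ∧
      LeadTermsDivideNoTerms ord g := by
  obtain ⟨g, hg1, hg2, hg3⟩ := exists_antichain ord f
  obtain ⟨h, hh1, hh2, hh3, hh4⟩ := exists_tail_reduced ord g Finset.univ
  refine ⟨h, hh1.trans hg1, ?_, fun i hi => ?_, ?_⟩
  · rintro δ hδ
    obtain ⟨i, hi, hle⟩ := hg2 hδ
    exact ⟨i, by rwa [hh2], by rwa [hh3 i hi]⟩
  · rw [hh2] at hi
    exact (hh4 i (Finset.mem_univ i) hi).1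
  · rintro i j _ ⟨δ, hδ, rfl⟩ hne hdvd
    have hj : ¬ IsFlat (g j) := by rw [← hh2]; exact not_isFlat hδ
    by_cases hi : IsFlat (h i)
    · rw [leadTerm_of_isFlat ord hi, zero_dvd_iff] at hdvd
      have := taylorCoeff_term (taylorCoeff (h j) δ) δ δ
      rw [hdvd, taylorCoeff_zero, if_pos rfl] at this
      exact hδ this.symm
    · rw [leadTerm_dvd_term_iff ord hi hδ] at hdvd
      rw [hh2] at hi
      rw [hh3 i hi] at hdvd
      by_cases hδj : δ = leadExp ord (g j)
      · by_cases hij : i = j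
        · subst hij
          refine hne ⟨rfl, ?_⟩
          rw [hδj, ← hh3 i hi]
          rfl
        · exact hg3 i j hij hi hj (hδj ▸ hdvd)
      · exact (hh4 j (Finset.mem_univ j) hj).2 i hi δ hδ hδj hdvd

/-! ### Standard bases and redundant flat members -/

/-- A generating family of an ideal whose leading monomials cover those of a standard basis is a
standard basis. -/
theorem IsStandardBasis.of_leadSet_subset {ord : LocalOrder} {n m : ℕ} {f : Fin n → SmoothGerm}
    {g : Fin m → SmoothGerm} {I : Ideal SmoothGerm} (hf : IsStandardBasis ord f I)
    (hg : Ideal.span (Set.range g) = I) (h : leadSet ord f ⊆ leadSet ord g) :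
    IsStandardBasis ord g I := by
  refine ⟨hg, le_antisymm ?_ ?_⟩
  · rw [hf.2, Ideal.span_le]
    rintro _ ⟨i, rfl⟩
    by_cases hi : IsFlat (f i)
    · simp only [leadTerm_of_isFlat ord hi]
      exact Ideal.zero_mem _
    · obtain ⟨k, hk, hle⟩ := h ⟨i, hi, le_rfl⟩
      exact Ideal.mem_of_dvd _ ((leadTerm_dvd_term_iff ord hk (leadCoeff_ne_zero ord hi)).2 hle)
        (Ideal.subset_span ⟨k, rfl⟩)
  · rw [Ideal.span_le]
    rintro _ ⟨i, rfl⟩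
    exact Ideal.subset_span ⟨g i, hg ▸ Ideal.subset_span ⟨i, rfl⟩, rfl⟩

/-- A flat member of a reduced standard basis that lies in the ideal generated by the others can be
dropped. -/
theorem IsReducedStandardBasis.removeNth {ord : LocalOrder} {m : ℕ} {g : Fin (m + 1) → SmoothGerm}
    {I : Ideal SmoothGerm} (hg : IsReducedStandardBasis ord g I) {j : Fin (m + 1)}
    (hj : IsFlat (g j)) (hmem : g j ∈ Ideal.span (g '' {i | i ≠ j})) :
    IsReducedStandardBasis ord (g ∘ j.succAbove) I := by
  obtain ⟨hsb, hlc, hred⟩ := hg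
  refine ⟨hsb.of_leadSet_subset ?_ ?_, fun i => hlc _, fun i k p hp hne => ?_⟩
  · have hr : Set.range (g ∘ j.succAbove) = g '' {i | i ≠ j} := by
      rw [Set.range_comp, Fin.range_succAbove]
      rfl
    rw [hr, ← hsb.1]
    refine le_antisymm (Ideal.span_mono (Set.image_subset_range _ _)) (Ideal.span_le.2 ?_)
    rintro _ ⟨i, rfl⟩
    by_cases hi : i = j
    · exact hi ▸ hmem
    · exact Ideal.subset_span ⟨i, hi, rfl⟩
  -- The dropped member is flat, so it covers no monomial.
  · rintro δ ⟨i, hi, hle⟩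
    obtain ⟨k, rfl⟩ := Fin.exists_succAbove_eq (x := i) (y := j) (fun e => hi (e ▸ hj))
    exact ⟨k, hi, hle⟩
  · exact hred _ _ p hp fun h => hne ⟨Fin.succAbove_right_injective h.1, h.2⟩

end SmoothGerm

theorem mainTheorem6 (ord : LocalOrder) (n : ℕ) (f : Fin n → SmoothGerm)
    (I : Ideal SmoothGerm) (hI : I = Ideal.span (Set.range f)) :
    (∃ m ≤ n, ∃ g : Fin m → SmoothGerm,
      I = Ideal.span (Set.range g) ∧ SmoothGerm.LeadTermsDivideNoTerms ord g) ∧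
    (SmoothGerm.IsStandardBasis ord f I →
      ∃ m ≤ n, ∃ g : Fin m → SmoothGerm,
        SmoothGerm.IsReducedStandardBasis ord g I ∧
        ∀ j, SmoothGerm.IsFlat (g j) → g j ∉ Ideal.span (g '' {i | i ≠ j})) := by
  classical
  obtain ⟨g, hg1, hg2, hg3, hg4⟩ := SmoothGerm.exists_reduced ord f
  refine ⟨⟨n, le_rfl, g, hI.trans hg1.symm, hg4⟩, fun hf => ?_⟩
  -- Take the least length: a redundant flat member could be dropped, giving a shorter reduced
  -- standard basis.
  have hex : ∃ m, m ≤ n ∧ ∃ g : Fin m → SmoothGerm, SmoothGerm.IsReducedStandardBasis ord g I :=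
    ⟨n, le_rfl, g, hf.of_leadSet_subset (hg1.trans hI.symm) hg2, hg3, hg4⟩
  obtain ⟨hm, h, hh⟩ := Nat.find_spec hex
  have hmin := fun k => Nat.find_min hex (m := k)
  generalize Nat.find hex = m at hm h hh hmin
  refine ⟨m, hm, h, hh, fun j hj hmem => ?_⟩
  cases m with
  | zero => exact j.elim0
  | succ m => exact hmin m m.lt_succ_self ⟨by omega, _, hh.removeNth hj hmem⟩
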